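/- Theorem (Bias Reduction through Fuzzification). Let $(\Omega,\mathcal F,\mathbb P)$ be a probability space, let $a,b\in\mathbb R$, and let $X_c:\Omega\to\mathbb R$ be a random variable with values in $[a,b]$ almost surely (in particular, $X_c$ may be a confounding variable). Let $t\ge 1$ and let $bin_1<bin_2<\dots<bin_t$ be real boundary points with $b\le bin_t$. Let $\hat X_c$ be the fuzzified variable with $t$ bins, that is, $\hat X_c=1$ if $X_c\le bin_1$, and $\hat X_c=j$ if $bin_{j-1}<X_c\le bin_j$ for some $2\le j\le t$ (with $\hat X_c=t+1$ on the null event $X_c>bin_t$). Then for every random variable $X_i$ on $\Omega$ with values in an arbitrary measurable space, $$I(\hat X_c;X_i)\le I(X_c;X_i),$$ where $I(X;Y)=D_{\mathrm{KL}}\big(P_{(X,Y)}\,\|\,P_X\otimes P_Y\big)\in[0,\infty]$ denotes mutual information, the Kullback–Leibler divergence (with natural logarithm) of the joint law from the product of the marginal laws. -/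

import Mathlib

open MeasureTheory

namespace Fuzzification

/-- The mutual information `I(X; Y)` of two random variables on `(Ω, μ)`, with natural logarithm and
values in `[0, ∞]`: the Kullback-Leibler divergence of the joint law of `(X, Y)` from the product
of the two marginal laws. -/
noncomputable def mutualInfo {Ω S T : Type*} [MeasurableSpace Ω] [MeasurableSpace S]
    [MeasurableSpace T] (X : Ω → S) (Y : Ω → T) (μ : Measure Ω) : ENNReal :=
  InformationTheory.klDiv (μ.map (fun ω => (X ω, Y ω))) ((μ.map X).prod (μ.map Y))

/-- The bin label of the value `x` for the boundary points `bin 0 < bin 1 < ... < bin (t - 1)`.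
The bins are numbered from `1` to `t`: the label is `1` if `x ≤ bin 0`, and `j + 1` if
`bin (j - 1) < x ≤ bin j` (see `binLabel_eq_one_iff` and `binLabel_eq_iff`).
It is `t + 1` if `x` lies beyond the last boundary point, in no bin. -/
noncomputable def binLabel {t : ℕ} (bin : Fin t → ℝ) (x : ℝ) : ℕ :=
  (Finset.univ.filter (fun j : Fin t => bin j < x)).card + 1

/-- The fuzzified (discretized) variable: the bin label of the value of `X`. -/
noncomputable def fuzzify {Ω : Type*} {t : ℕ} (bin : Fin t → ℝ) (X : Ω → ℝ) : Ω → ℕ :=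
  fun ω => binLabel bin (X ω)

theorem binLabel_le_iff {t : ℕ} {bin : Fin t → ℝ} (hbin : StrictMono bin) (x : ℝ) (j : Fin t) :
    binLabel bin x ≤ (j : ℕ) + 1 ↔ x ≤ bin j := by
  unfold binLabel
  constructor
  · intro h
    by_contra hx
    have hx' : bin j < x := not_le.mp hx
    have hsub : Finset.Iic j ⊆ Finset.univ.filter (fun i : Fin t => bin i < x) := by
      intro i hi
      simp only [Finset.mem_filter, Finset.mem_univ, true_and]
      exact lt_of_le_of_lt (hbin.monotone (Finset.mem_Iic.mp hi)) hx'
    have hc := Finset.card_le_card hsub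
    rw [Fin.card_Iic] at hc
    omega
  · intro h
    have hsub : Finset.univ.filter (fun i : Fin t => bin i < x) ⊆ Finset.Iio j := by
      intro i hi
      simp only [Finset.mem_filter, Finset.mem_univ, true_and] at hi
      exact Finset.mem_Iio.mpr (hbin.lt_iff_lt.mp (lt_of_lt_of_le hi h))
    have hc := Finset.card_le_card hsub
    rw [Fin.card_Iio] at hc
    omega

theorem binLabel_eq_one_iff {t : ℕ} {bin : Fin t → ℝ} (hbin : StrictMono bin) (ht : 0 < t)
    (x : ℝ) : binLabel bin x = 1 ↔ x ≤ bin ⟨0, ht⟩ := by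
  have h := binLabel_le_iff hbin x ⟨0, ht⟩
  have h1 : 1 ≤ binLabel bin x := Nat.le_add_left 1 _
  rw [← h]
  simp only [zero_add]
  omega

theorem binLabel_eq_iff {t : ℕ} {bin : Fin t → ℝ} (hbin : StrictMono bin) (x : ℝ) (j : ℕ)
    (hj : j + 1 < t) : binLabel bin x = j + 2 ↔
      bin ⟨j, Nat.lt_of_succ_lt hj⟩ < x ∧ x ≤ bin ⟨j + 1, hj⟩ := by
  have h := binLabel_le_iff hbin x ⟨j, Nat.lt_of_succ_lt hj⟩
  have h' := binLabel_le_iff hbin x ⟨j + 1, hj⟩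
  rw [← h', ← not_le, ← h]
  simp only
  omega

end Fuzzification

namespace Fuzzification

/-! The fuzzified variable is a measurable function `g` of `Xc`, so this is data processing. The map
`g × id` carries the joint law to the joint law and the product of marginals to the product of
marginals, and KL divergence cannot grow under a common pushforward (`klDiv_map_le`). -/

theorem measurable_binLabel {t : ℕ} (bin : Fin t → ℝ) : Measurable (binLabel bin) := by
  -- Counting as a finite sum of indicators of open rays reduces measurability to each term.
  have h : binLabel bin =
      fun x => (∑ j : Fin t, (Set.Ioi (bin j)).indicator (fun _ => (1 : ℕ)) x) + 1 := by
    ext x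
    simp only [binLabel, Finset.card_filter, Set.indicator_apply, Set.mem_Ioi]
  rw [h]
  exact (Finset.measurable_sum _ fun j _ =>
    measurable_const.indicator measurableSet_Ioi).add_const 1

/-- Data-processing inequality: mutual information does not increase under a measurable function
of the first variable. -/
theorem mutualInfo_comp_left_le {Ω S T U : Type*} [MeasurableSpace Ω] [MeasurableSpace S]
    [MeasurableSpace T] [MeasurableSpace U] {μ : Measure Ω} [IsFiniteMeasure μ]
    {X : Ω → S} {Y : Ω → T} {g : S → U} (hX : Measurable X) (hY : Measurable Y)
    (hg : Measurable g) : mutualInfo (fun ω => g (X ω)) Y μ ≤ mutualInfo X Y μ := by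
  have hG : Measurable (Prod.map g (id : T → T)) := hg.prodMap measurable_id
  have hjoint : μ.map (fun ω => (g (X ω), Y ω)) =
      (μ.map (fun ω => (X ω, Y ω))).map (Prod.map g id) :=
    (Measure.map_map hG (hX.prodMk hY)).symm
  have hprod : (μ.map (fun ω => g (X ω))).prod (μ.map Y) =
      ((μ.map X).prod (μ.map Y)).map (Prod.map g id) := by
    rw [← Measure.map_prod_map _ _ hg measurable_id, Measure.map_map hg hX, Measure.map_id]
    rfl
  unfold mutualInfo
  rw [hjoint, hprod]
  exact InformationTheory.klDiv_map_le _ _ hG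

end Fuzzification

theorem mainTheorem5 {Ω S : Type*} [MeasurableSpace Ω] [MeasurableSpace S]
    (μ : Measure Ω) [IsProbabilityMeasure μ]
    (a b : ℝ) (Xc : Ω → ℝ) (hXc : Measurable Xc) (hrange : ∀ᵐ ω ∂μ, Xc ω ∈ Set.Icc a b)
    (t : ℕ) (ht : 0 < t) (bin : Fin t → ℝ) (hbin : StrictMono bin)
    (hlast : b ≤ bin ⟨t - 1, Nat.sub_one_lt_of_lt ht⟩)
    (Xi : Ω → S) (hXi : Measurable Xi) :
    Fuzzification.mutualInfo (Fuzzification.fuzzify bin Xc) Xi μ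
      ≤ Fuzzification.mutualInfo Xc Xi μ := by
  -- By definitional unfolding, `fuzzify bin Xc` is `g ∘ Xc` with `g = binLabel bin`.
  exact Fuzzification.mutualInfo_comp_left_le hXc hXi (Fuzzification.measurable_binLabel bin)
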